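/- **Setting.** Let $\bar L,\mu,\chi$ be real and $n,B\ge1$, $K,N\ge 0$ integers. A decentralized finite-sum variational inequality on $\mathbb R^d$ with $M$ workers consists of operators $F_{m,i}:\mathbb R^d\to\mathbb R^d$ ($m=1,\dots,M$, $i=1,\dots,n$) and a regularizer $g$; put $F_m=\frac1n\sum_i F_{m,i}$ and $F=\sum_{m}F_m$. A solution is a point $z^*$ with $\langle F(z^*),z-z^*\rangle+g(z)-g(z^*)\ge0$ for all $z\in\mathbb R^d$. *Network.* At each time $t$ there is a directed graph $\mathcal G(t)$ on the workers and a gossip matrix $\mathbf W(t)\in\mathbb R^{M\times M}$, acting on $(\mathbb R^d)^M$ as $\mathbf W(t)\otimes\mathbf I_d$. We say that $(\mathcal G,\mathbf W)$ is an admissible $B$-connected network with characteristic number $\chi\ge1$ if for all $t$: the graph with edges $\bigcup_{\tau=t}^{t+B-1}\mathcal E(\tau)$ is connected; for $i\ne j$, $w_{ij}(t)\neq0$ iff $(i,j)\in\mathcal E(t)$; $\ker\mathbf W(t)$ contains all $(z_1,\dots,z_M)$ with $z_1=\dots=z_M$; $\operatorname{range}\mathbf W(t)\subset\{\sum_m z_m=0\}$;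 and, with $\mathbf W_B(t)=\mathbf I-\prod_{\tau=t}^{t+B-1}(\mathbf I-\mathbf W(\tau))$ (later factors on the left), $\|\mathbf W_B(t)z-z\|^2\le(1-\chi^{-1})\|z\|^2$ for all $z\in\operatorname{range}\mathbf W_B(t)$. *Procedures.* Every worker $m$ has a memory $\mathcal M_m\subset\mathbb R^d$, initially $\{0\}$. A procedure decides adaptively (and possibly using coin tosses with finitely many outcomes) between the following steps. Local iteration: each worker $m$ draws, uniformly without replacement and independently of everything else, a batch $S_m$ of $b_m\in\{0,\dots,n\}$ of its operators (this costs worker $m$ $b_m$ local computations) and adds to $\mathcal M_m$ finitely many points of the span of the points $z'$, $\sum_{i\in S_m}F_{m,i}(z'')$ and $\mathrm{prox}_{\rho g}(w)$, where $z',z''\in\mathcal M_m$, $\rho>0$ and $w\in\mathrm{span}\{z''',\sum_{i\in S_m}F_{m,i}(z'')\,:\,z'',z'''\in\mathcal M_m\}$. Communication round number $t=0,1,\dots$: every $\mathcal M_m$ is replaced by the span of $\mathcal M_m$ and of all $\mathcal M_i$ with $(i,m)\in\mathcal E(t)$. In the end it outputs some $\hat z\in\mathrm{span}\bigcup_m\mathcal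 M_m$. The procedure has $K$ communication rounds and $N$ local computations if at most $K$ rounds are performed and every worker spends at most $N$ local computations. **Theorem.** There is a universal constant $c>0$ with the following property. Let $\mu>0$, $\bar L\ge\sqrt n\,\mu$, $\chi\ge3$, $n,B\ge1$, $K,N\ge0$, and put $L=\bar L/\sqrt n$ and $M=\lfloor\chi\rfloor$. For all sufficiently large $d$ there is a decentralized finite-sum variational inequality on $\mathbb R^d$ with $M$ workers and $g\equiv0$, with a solution $z^*\neq0$, such that each $F_m$ is $L$-Lipschitz, $\frac1n\sum_i\|F_{m,i}(u)-F_{m,i}(v)\|^2\le\bar L^2\|u-v\|^2$ for all $m,u,v$, $F$ is $\mu$-strongly monotone and each $F_m$ is $\frac\mu M$-strongly monotone; and there are gossip matrices $\mathbf W(t)$ which, with the following rotating stars, form an admissible $B$-connected network with characteristic number $\chi$: $\mathcal G(t)$ is empty unless $B\mid t+1$, and $\mathcal G(sB+B-1)$, for $s=0,1,2,\dots$, is the star on all workers with centre $2+(s\bmod (M-2))$ (edges in both directions). For every procedure on this problem and network with $K$ communication rounds and $N$ local computations, with $R_0^2=\|0-z^*\|^2$, $$\mathbb E\|\hat z-z^*\|^2\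 \ge\ c\,\exp\Bigl(-\frac{64}{1+\sqrt{2L^2/\mu^2+1}}\cdot\frac{K}{B\chi}\Bigr)R_0^2$$ and $$\mathbb E\|\hat z-z^*\|^2\ \ge\ c\,\exp\Bigl(-\frac{16}{n+\sqrt{2n\bar L^2/\mu^2+n^2}}\cdot N\Bigr)R_0^2 .$$ -/

import Mathlib

noncomputable section

namespace DecentralizedVI

/-- The space of a single decision variable, with the Euclidean norm. -/
abbrev Vec (d : ℕ) : Type := EuclideanSpace ℝ (Fin d)

/-! ### Problems -/

/-- A decentralized finite-sum variational inequality: worker `m` of `M` stores the operators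
`F m 0, …, F m (n - 1)`, and `g` is the common regularizer with values in `ℝ ∪ {+∞}`. -/
structure Problem (M n d : ℕ) where
  F : Fin M → Fin n → Vec d → Vec d
  g : Vec d → EReal

/-- `G` is Lipschitz with constant `L`. -/
def IsLipschitz {d : ℕ} (L : ℝ) (G : Vec d → Vec d) : Prop :=
  ∀ u v, ‖G u - G v‖ ≤ L * ‖u - v‖

/-- `G` is strongly monotone with modulus `μ`. -/
def IsStronglyMonotone {d : ℕ} (μ : ℝ) (G : Vec d → Vec d) : Prop :=
  ∀ u v, μ * ‖u - v‖ ^ 2 ≤ inner ℝ (G u - G v) (u - v)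

namespace Problem

variable {M n d : ℕ}

/-- The operator of worker `m`: the average of its `n` operators. -/
def workerOp (P : Problem M n d) (m : Fin M) (z : Vec d) : Vec d :=
  (1 / (n : ℝ)) • ∑ i, P.F m i z

/-- The operator of the whole problem: the sum over the workers. -/
def globalOp (P : Problem M n d) (z : Vec d) : Vec d :=
  ∑ m, P.workerOp m z

/-- For each worker, its collection of operators is `L`-average Lipschitz. -/
def IsAverageLipschitz (P : Problem M n d) (L : ℝ) : Prop :=
  ∀ m u v, (1 / (n : ℝ)) * ∑ i, ‖P.F m i u - P.F m i v‖ ^ 2 ≤ L ^ 2 * ‖u - v‖ ^ 2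

/-- `zs` solves the variational inequality `⟨F(zs), z - zs⟩ + g(z) - g(zs) ≥ 0` for all `z`. -/
def IsSolution (P : Problem M n d) (zs : Vec d) : Prop :=
  P.g zs ≠ ⊤ ∧
    ∀ z, P.g zs ≤ ((inner ℝ (P.globalOp zs) (z - zs) : ℝ) : EReal) + P.g z

end Problem

/-- `p` is a value of `prox_{ρ g}` at `z`, i.e. a minimizer of
`y ↦ ρ g(y) + ‖y - z‖² / 2`. -/
def IsProx {d : ℕ} (g : Vec d → EReal) (ρ : ℝ) (z p : Vec d) : Prop :=
  ∀ y, (ρ : EReal) * g p + ((‖p - z‖ ^ 2 / 2 : ℝ) : EReal)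
    ≤ (ρ : EReal) * g y + ((‖y - z‖ ^ 2 / 2 : ℝ) : EReal)

/-! ### Time-varying networks -/

/-- The action of `A ⊗ I_d` on a family of vectors, one for each worker. -/
def gossip {M d : ℕ} (A : Matrix (Fin M) (Fin M) ℝ) (z : Fin M → Vec d) : Fin M → Vec d :=
  fun i => ∑ j, A i j • z j

/-- The product `(I - W(t+T-1)) ⋯ (I - W(t+1)) (I - W(t))`. -/
def mixing {M : ℕ} (W : ℕ → Matrix (Fin M) (Fin M) ℝ) (t : ℕ) : ℕ → Matrix (Fin M) (Fin M) ℝ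
  | 0 => 1
  | T + 1 => (1 - W (t + T)) * mixing W t T

/-- The multi-consensus gossip matrix `W_T(t) = I - ∏_{τ = t}^{t+T-1} (I - W(τ))`. -/
def multiGossip {M : ℕ} (W : ℕ → Matrix (Fin M) (Fin M) ℝ) (T t : ℕ) :
    Matrix (Fin M) (Fin M) ℝ :=
  1 - mixing W t T

/-- The gossip matrices `W` are compatible with the `B`-connected time-varying network `G` and
have characteristic number `χ`, as operators on the families of vectors of dimension `d`. -/
structure IsGossipNetwork {M : ℕ} (d : ℕ) (G : ℕ → Digraph (Fin M))
    (W : ℕ → Matrix (Fin M) (Fin M) ℝ) (B : ℕ) (χ : ℝ) : Prop where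
  /-- the union of the edges over any `B` consecutive times is (strongly) connected -/
  connected : ∀ t i j,
    Relation.ReflTransGen (fun a b => ∃ τ, t ≤ τ ∧ τ < t + B ∧ (G τ).Adj a b) i j
  /-- off the diagonal, `W(t)` is supported exactly on the edges -/
  support : ∀ t i j, i ≠ j → (W t i j ≠ 0 ↔ (G t).Adj i j)
  /-- the kernel of `W(t)` contains the consensus space -/
  ker : ∀ t (z : Fin M → Vec d), (∀ i j, z i = z j) → gossip (W t) z = 0
  /-- the range of `W(t)` is contained in the space of families with sum zero -/
  range : ∀ t (z : Fin M → Vec d), ∑ i, gossip (W t) z i = 0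
  /-- the characteristic number is at least one -/
  one_le : 1 ≤ χ
  /-- contraction on the range of `W_B(t)` -/
  contraction : ∀ t (z : Fin M → Vec d), (∃ y, z = gossip (multiGossip W B t) y) →
    ∑ i, ‖gossip (multiGossip W B t) z i - z i‖ ^ 2 ≤ (1 - χ⁻¹) * ∑ i, ‖z i‖ ^ 2

/-- Rotating stars interleaved with empty graphs. Times start at `0` and workers are numbered
`0, …, M - 1`. The graph is empty except at the last time of each period of length `B`; at the end
of period number `s = 0, 1, …` it is the star, with edges in both directions, whose centre is
the worker `1 + (s mod (M - 2))`. The workers `0` and `M - 1` are never centres. -/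
def rotatingStar (M B : ℕ) (t : ℕ) : Digraph (Fin M) where
  Adj i j := B ∣ t + 1 ∧ i ≠ j ∧
    ((i : ℕ) = 1 + (t / B) % (M - 2) ∨ (j : ℕ) = 1 + (t / B) % (M - 2))

/-! ### Procedures -/

/-- The points that a worker with memory `A` may form in one local iteration, when `G` is the sum
of the sampled operators:
the span of `z'`, `G(z'')` and `prox_{ρ g}(span {z''', G(z'')})`, for points
`z', z'', z'''` of `A` and `ρ > 0`. -/
def localSpan {d : ℕ} (g : Vec d → EReal) (G : Vec d → Vec d) (A : Set (Vec d)) :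
    Submodule ℝ (Vec d) :=
  Submodule.span ℝ
    (A ∪ G '' A ∪ {p | ∃ ρ : ℝ, 0 < ρ ∧ ∃ w ∈ Submodule.span ℝ (A ∪ G '' A), IsProx g ρ w p})

/-- The memories after a communication over the graph `G`. A worker keeps its own memory. -/
def communicated {M d : ℕ} (G : Digraph (Fin M)) (mem : Fin M → Set (Vec d)) :
    Fin M → Set (Vec d) :=
  fun m => (Submodule.span ℝ (⋃ i ∈ {i | i = m ∨ G.Adj i m}, mem i) : Set (Vec d))

/-- The possible outcomes of drawing, for each worker `m`, a batch of `b m` of its `n` operators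
(without replacement). -/
def batches {M : ℕ} (n : ℕ) (b : Fin M → ℕ) : Finset (Fin M → Finset (Fin n)) :=
  Fintype.piFinset fun m => Finset.powersetCard (b m) Finset.univ

/-- An adaptive procedure, as a decision tree. It may
* stop with a global output;
* perform a communication round;
* perform a local iteration: each worker `m` draws a batch of size `b m`, and, if `S` is the family
  of the drawn batches, then the points `add S m` are added to the memory of worker `m` and the
  procedure goes on as `next S`;
* toss a coin with finitely many outcomes `j`, of probabilities `w j`, and go on as `next j`. -/
inductive Procedure (M n d : ℕ) : Type
  | output (z : Vec d) : Procedure M n d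
  | communicate (next : Procedure M n d) : Procedure M n d
  | compute (b : Fin M → ℕ) (add : (Fin M → Finset (Fin n)) → Fin M → Finset (Vec d))
      (next : (Fin M → Finset (Fin n)) → Procedure M n d) : Procedure M n d
  | coin (k : ℕ) (w : Fin k → ℝ) (next : Fin k → Procedure M n d) : Procedure M n d

namespace Procedure

variable {M n d : ℕ}

/-- The expectation of `φ ẑ`, where `ẑ` is the output of the procedure: all batches are uniformly
distributed and independent. -/
def expect (φ : Vec d → ℝ) : Procedure M n d → ℝ
  | output z => φ z
  | communicate next => next.expect φ
  | compute b _ next => (∑ S ∈ batches n b, (next S).expect φ) / ((batches n b).card : ℝ)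
  | coin _ w next => ∑ j, w j * (next j).expect φ

/-- `Admissible P G K N t mem p`: started with the memories `mem`, after `t` communication rounds
have taken place over the network `G`, the procedure `p` follows the rules for the problem `P`,
uses at most `K` communication rounds and draws at most `N m` operators of each worker `m`. -/
def Admissible (P : Problem M n d) (G : ℕ → Digraph (Fin M)) :
    ℕ → (Fin M → ℕ) → ℕ → (Fin M → Set (Vec d)) → Procedure M n d → Prop
  | _, _, _, mem, output z => z ∈ Submodule.span ℝ (⋃ m, mem m)
  | K, N, t, mem, communicate next =>
      1 ≤ K ∧ Admissible P G (K - 1) N (t + 1) (communicated (G t) mem) next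
  | K, N, t, mem, compute b add next =>
      (∀ m, b m ≤ n ∧ b m ≤ N m) ∧
      ∀ S ∈ batches n b,
        (∀ m, ∀ z ∈ add S m, z ∈ localSpan P.g (fun u => ∑ i ∈ S m, P.F m i u) (mem m)) ∧
        Admissible P G K (fun m => N m - b m) t (fun m => mem m ∪ (add S m : Set (Vec d))) (next S)
  | K, N, t, mem, coin _ w next =>
      (∀ j, 0 ≤ w j) ∧ ∑ j, w j = 1 ∧ ∀ j, Admissible P G K N t mem (next j)

/-- The procedure `p` is admissible from the start, where every worker has the memory `{0}`, with
at most `K` communication rounds and at most `N` local computations of each worker. -/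
def IsRun (P : Problem M n d) (G : ℕ → Digraph (Fin M)) (K N : ℕ) (p : Procedure M n d) : Prop :=
  Admissible P G K (fun _ => N) 0 (fun _ => {0}) p

end Procedure

end DecentralizedVI

end

/-! The hard operator is `μ` times the identity plus a skew-symmetric tridiagonal chain of weight `a
= L / 2`, minus a source at the first coordinate. The skew part does not affect monotonicity. With a
diagonal correction at the last coordinate, the zero is exactly `(q, q², …, q^d)`, where `μ q + a q²
= a` (`globalOp_geomVec`) and `exp (-2μ/L) ≤ q²` (`exists_rate`). A point supported on `k`
coordinates therefore has squared error at least `(q^(2k) - q^(2d)) ‖z*‖²` (`dist_geomVec_ge`), and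
large `d` makes the subtracted term harmless. It remains to bound the support reached, in two ways.

Communication: odd links of the chain belong to worker `0`, even links to worker `M - 1`, so each
new coordinate must be carried from one to the other. Neither is ever a centre. A star informs only
its centre unless the centre already knows, and the next `M - 2` centres are distinct, so each
transfer takes `M - 1` stars, that is about `B (M - 1)` rounds. `level` records this bound for each
worker; `level_le_level_succ` and `ne_owner_level` show that it survives communication and
computation, which gives `IsChain.le_expect_of_communications`.

Computation: link `k` is stored, with weight `n a`, only in operator `k % n` of its owner. A local
iteration adds at most one coordinate, and only if that operator is drawn, which a batch of size `b`
does with probability `b / n`. The potential `exp (-δ (k + remaining budget of the two owners / n))`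
bounds the expectation from below by convexity of `exp` (`IsChain.le_expect_of_computations`). -/

noncomputable section

namespace DecentralizedVI

variable {M n d : ℕ}

/-! ### Coordinates -/

/-- The coordinates of `z`, numbered `1, …, d` and padded with zeros. -/
def pad (z : Vec d) : ℕ → ℝ
  | 0 => 0
  | j + 1 => if h : j < d then z ⟨j, h⟩ else 0

@[simp] lemma pad_zero (z : Vec d) : pad z 0 = 0 := rfl

lemma pad_succ_of_le (z : Vec d) {j : ℕ} (h : d ≤ j) : pad z (j + 1) = 0 := by
  simp [pad, h]

@[simp] lemma pad_succ_val (z : Vec d) (j : Fin d) : pad z (j + 1) = z j := by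
  simp [pad]

lemma pad_add (z w : Vec d) (j : ℕ) : pad (z + w) j = pad z j + pad w j := by
  cases j with
  | zero => simp
  | succ j => by_cases h : j < d <;> simp [pad, h]

lemma pad_sub (z w : Vec d) (j : ℕ) : pad (z - w) j = pad z j - pad w j := by
  cases j with
  | zero => simp
  | succ j => by_cases h : j < d <;> simp [pad, h]

lemma pad_smul (c : ℝ) (z : Vec d) (j : ℕ) : pad (c • z) j = c * pad z j := by
  cases j with
  | zero => simp
  | succ j => by_cases h : j < d <;> simp [pad, h]

lemma norm_sq_eq_sum_pad (z : Vec d) : ‖z‖ ^ 2 = ∑ j ∈ Finset.range d, pad z (j + 1) ^ 2 := by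
  rw [EuclideanSpace.real_norm_sq_eq, Finset.sum_range]
  simp

lemma inner_eq_sum_pad (z w : Vec d) :
    inner ℝ z w = ∑ j ∈ Finset.range d, pad z (j + 1) * pad w (j + 1) := by
  rw [PiLp.inner_apply, Finset.sum_range]
  simp [mul_comm]

/-- The vectors supported on the first `k` coordinates. -/
def firstCoords (d k : ℕ) : Submodule ℝ (Vec d) where
  carrier := {z | ∀ j, k ≤ j → pad z (j + 1) = 0}
  add_mem' := fun hz hw j hj => by rw [pad_add, hz j hj, hw j hj, add_zero]
  zero_mem' := fun j _ => by simp [pad]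
  smul_mem' := fun c z hz j hj => by rw [pad_smul, hz j hj, mul_zero]

lemma firstCoords_mono {k l : ℕ} (h : k ≤ l) : firstCoords d k ≤ firstCoords d l :=
  fun _ hz j hj => hz j (h.trans hj)

/-! ### Tridiagonal operators -/

/-- The sum of the skew-symmetric tridiagonal operator with weight `α k` between the coordinates
`k` and `k + 1`, and the diagonal operator with weight `β j` at the coordinate `j + 1`. -/
def tridiag (α β : ℕ → ℝ) : Vec d →ₗ[ℝ] Vec d where
  toFun z := WithLp.toLp 2 fun j : Fin d =>
    β j * pad z (j + 1) + α (j + 1) * pad z (j + 2) - α j * pad z j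
  map_add' z w := by
    ext j
    simp only [pad_add, PiLp.add_apply]
    ring
  map_smul' c z := by
    ext j
    simp only [pad_smul, PiLp.smul_apply, RingHom.id_apply, smul_eq_mul]
    ring

lemma tridiag_apply (α β : ℕ → ℝ) (z : Vec d) (j : Fin d) :
    tridiag α β z j = β j * pad z (j + 1) + α (j + 1) * pad z (j + 2) - α j * pad z j := rfl

lemma pad_tridiag (α β : ℕ → ℝ) (z : Vec d) {j : ℕ} (hj : j < d) :
    pad (tridiag α β z) (j + 1)
      = β j * pad z (j + 1) + α (j + 1) * pad z (j + 2) - α j * pad z j :=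
  (pad_succ_val _ ⟨j, hj⟩).trans (tridiag_apply α β z ⟨j, hj⟩)

lemma sum_tridiag {ι : Type*} (s : Finset ι) (α β : ι → ℕ → ℝ) (z : Vec d) :
    ∑ i ∈ s, tridiag (α i) (β i) z
      = tridiag (fun k => ∑ i ∈ s, α i k) (fun k => ∑ i ∈ s, β i k) z := by
  ext j
  simp only [WithLp.ofLp_sum, Finset.sum_apply, tridiag_apply, Finset.sum_sub_distrib,
    Finset.sum_add_distrib, Finset.sum_mul]

lemma smul_tridiag (c : ℝ) (α β : ℕ → ℝ) (z : Vec d) :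
    c • tridiag α β z = tridiag (fun k => c * α k) (fun k => c * β k) z := by
  ext j
  simp only [PiLp.smul_apply, tridiag_apply, smul_eq_mul]
  ring

/-- The skew-symmetric terms telescope, with vanishing ends because of the zero padding. -/
lemma inner_tridiag_self (α β : ℕ → ℝ) (z : Vec d) :
    inner ℝ (tridiag α β z) z = ∑ j ∈ Finset.range d, β j * pad z (j + 1) ^ 2 := by
  have h : ∑ j ∈ Finset.range d, (α (j + 1) * pad z (j + 1) * pad z (j + 2)
      - α j * pad z j * pad z (j + 1)) = 0 := by
    rw [Finset.sum_range_sub (fun j => α j * pad z j * pad z (j + 1)), pad_succ_of_le z le_rfl]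
    simp
  rw [inner_eq_sum_pad, ← add_zero (∑ j ∈ Finset.range d, β j * _), ← h, ← Finset.sum_add_distrib]
  refine Finset.sum_congr rfl fun j hj => ?_
  rw [pad_tridiag _ _ _ (Finset.mem_range.1 hj)]
  ring

/-- The hypotheses split the matrix into `2 × 2` skew blocks and separate diagonal entries, so no
cross terms survive. Equality fails only through the links `0` and `d`, which lead outside the
coordinates. -/
lemma norm_sq_tridiag_le (α β : ℕ → ℝ) (hα : ∀ j, α j * α (j + 1) = 0)
    (h₀ : ∀ j, β j * α j = 0) (h₁ : ∀ j, β j * α (j + 1) = 0) (z : Vec d) :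
    ‖tridiag α β z‖ ^ 2
      ≤ ∑ j ∈ Finset.range d, (β j ^ 2 + α j ^ 2 + α (j + 1) ^ 2) * pad z (j + 1) ^ 2 := by
  have e₁ : ∑ j ∈ Finset.range d, (α (j + 1) ^ 2 * pad z (j + 1) ^ 2 - α j ^ 2 * pad z j ^ 2)
      = α d ^ 2 * pad z d ^ 2 := by
    rw [Finset.sum_range_sub (fun j => α j ^ 2 * pad z j ^ 2)]
    simp
  have e₂ : ∑ j ∈ Finset.range d,
      (α j ^ 2 * pad z (j + 1) ^ 2 - α (j + 1) ^ 2 * pad z (j + 2) ^ 2)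
      = α 0 ^ 2 * pad z 1 ^ 2 := by
    rw [Finset.sum_range_sub' (fun j => α j ^ 2 * pad z (j + 1) ^ 2), pad_succ_of_le z le_rfl]
    simp
  have e₃ : ∑ j ∈ Finset.range d, (β j ^ 2 + α j ^ 2 + α (j + 1) ^ 2) * pad z (j + 1) ^ 2
      = ‖tridiag α β z‖ ^ 2 + α d ^ 2 * pad z d ^ 2 + α 0 ^ 2 * pad z 1 ^ 2 := by
    rw [← e₁, ← e₂, norm_sq_eq_sum_pad, ← Finset.sum_add_distrib, ← Finset.sum_add_distrib]
    refine Finset.sum_congr rfl fun j hj => ?_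
    rw [pad_tridiag _ _ _ (Finset.mem_range.1 hj)]
    linear_combination (2 * pad z (j + 2) * pad z j) * hα j
      + (2 * pad z (j + 1) * pad z j) * h₀ j - (2 * pad z (j + 1) * pad z (j + 2)) * h₁ j
  rw [e₃]
  nlinarith [mul_nonneg (sq_nonneg (α d)) (sq_nonneg (pad z d)),
    mul_nonneg (sq_nonneg (α 0)) (sq_nonneg (pad z 1))]

lemma tridiag_mem_firstCoords_succ (α β : ℕ → ℝ) {k : ℕ} {z : Vec d}
    (hz : z ∈ firstCoords d k) : tridiag α β z ∈ firstCoords d (k + 1) := by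
  intro j hj
  by_cases hjd : j < d
  · obtain ⟨i, rfl⟩ : ∃ i, j = i + 1 := ⟨j - 1, by omega⟩
    rw [pad_tridiag _ _ _ hjd, hz _ (by omega), hz _ (by omega), hz i (by omega)]
    ring
  · exact pad_succ_of_le _ (by omega)

lemma tridiag_mem_firstCoords (α β : ℕ → ℝ) {k : ℕ} {z : Vec d}
    (hα : α k = 0) (hz : z ∈ firstCoords d k) : tridiag α β z ∈ firstCoords d k := by
  intro j hj
  by_cases hjd : j < d
  · rw [pad_tridiag _ _ _ hjd, hz _ (by omega), hz _ (by omega)]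
    rcases hj.eq_or_lt with rfl | h
    · simp [hα]
    · obtain ⟨i, rfl⟩ : ∃ i, j = i + 1 := ⟨j - 1, by omega⟩
      rw [hz i (by omega)]
      ring
  · exact pad_succ_of_le _ (by omega)

/-! ### Geometric vectors -/

/-- The vector `(q, q², …, q^d)`. -/
def geomVec (d : ℕ) (q : ℝ) : Vec d := WithLp.toLp 2 fun j => q ^ ((j : ℕ) + 1)

lemma pad_geomVec (q : ℝ) {j : ℕ} (hj : j < d) : pad (geomVec d q) (j + 1) = q ^ (j + 1) := by
  simp [pad, geomVec, hj]

/-- This is the geometric sum when `k ≤ d`; otherwise the left side is nonpositive. Allowing both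
cases makes the induction on `d` direct. -/
lemma sum_geom_tail {r : ℝ} (h0 : 0 ≤ r) (h1 : r ≤ 1) (k d : ℕ) :
    r * (r ^ k - r ^ d)
      ≤ (1 - r) * ∑ j ∈ Finset.range d, (if k ≤ j then r ^ (j + 1) else 0) := by
  induction d with
  | zero =>
    have := pow_le_one₀ (n := k) h0 h1
    simp only [pow_zero, Finset.range_zero, Finset.sum_empty, mul_zero]
    exact mul_nonpos_of_nonneg_of_nonpos h0 (by linarith)
  | succ d ih =>
    rw [Finset.sum_range_succ, mul_add]
    split_ifs with h
    · have e : r * (r ^ k - r ^ (d + 1)) = r * (r ^ k - r ^ d) + (1 - r) * r ^ (d + 1) := by ring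
      linarith
    · have h2 : r ^ k ≤ r ^ (d + 1) := pow_le_pow_of_le_one h0 h1 (by omega)
      have h3 : 0 ≤ (1 - r) * ∑ j ∈ Finset.range d, (if k ≤ j then r ^ (j + 1) else 0) :=
        mul_nonneg (by linarith) (Finset.sum_nonneg fun j _ => by split_ifs <;> positivity)
      have h4 : r * (r ^ k - r ^ (d + 1)) ≤ 0 :=
        mul_nonpos_of_nonneg_of_nonpos h0 (by linarith)
      linarith

lemma norm_sq_geomVec_le (q : ℝ) :
    (1 - q ^ 2) * ‖geomVec d q‖ ^ 2 ≤ q ^ 2 := by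
  have e : ‖geomVec d q‖ ^ 2 = q ^ 2 * ∑ j ∈ Finset.range d, (q ^ 2) ^ j := by
    rw [norm_sq_eq_sum_pad, Finset.mul_sum]
    refine Finset.sum_congr rfl fun j hj => ?_
    rw [pad_geomVec q (Finset.mem_range.1 hj)]
    ring
  have h2 := mul_neg_geom_sum (q ^ 2) d
  have h3 : 0 ≤ (q ^ 2) ^ d := by positivity
  rw [e, mul_left_comm, h2]
  nlinarith [sq_nonneg q]

/-- A vector supported on the first `k` coordinates is far from a geometric vector. -/
lemma dist_geomVec_ge {q : ℝ} (h1 : q ^ 2 < 1) {k : ℕ} {z : Vec d} (hz : z ∈ firstCoords d k) :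
    ((q ^ 2) ^ k - (q ^ 2) ^ d) * ‖geomVec d q‖ ^ 2 ≤ ‖z - geomVec d q‖ ^ 2 := by
  rcases le_total d k with hk | hk
  · have : (q ^ 2) ^ k ≤ (q ^ 2) ^ d := pow_le_pow_of_le_one (sq_nonneg q) h1.le hk
    have : ((q ^ 2) ^ k - (q ^ 2) ^ d) * ‖geomVec d q‖ ^ 2 ≤ 0 :=
      mul_nonpos_of_nonpos_of_nonneg (by linarith) (sq_nonneg _)
    nlinarith [sq_nonneg ‖z - geomVec d q‖]
  have hk' : 0 ≤ (q ^ 2) ^ k - (q ^ 2) ^ d :=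
    sub_nonneg.2 (pow_le_pow_of_le_one (sq_nonneg q) h1.le hk)
  have h2 : ∑ j ∈ Finset.range d, (if k ≤ j then (q ^ 2) ^ (j + 1) else 0)
      ≤ ‖z - geomVec d q‖ ^ 2 := by
    rw [norm_sq_eq_sum_pad]
    refine Finset.sum_le_sum fun j hj => ?_
    split_ifs with h
    · rw [pad_sub, hz j h, pad_geomVec q (Finset.mem_range.1 hj)]
      exact le_of_eq (by ring)
    · positivity
  have h3 := sum_geom_tail (sq_nonneg q) h1.le k d
  have h4 : 0 < 1 - q ^ 2 := by linarith
  refine le_of_mul_le_mul_left ?_ h4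
  calc (1 - q ^ 2) * (((q ^ 2) ^ k - (q ^ 2) ^ d) * ‖geomVec d q‖ ^ 2)
      = ((q ^ 2) ^ k - (q ^ 2) ^ d) * ((1 - q ^ 2) * ‖geomVec d q‖ ^ 2) := by ring
    _ ≤ ((q ^ 2) ^ k - (q ^ 2) ^ d) * q ^ 2 :=
        mul_le_mul_of_nonneg_left (norm_sq_geomVec_le q) hk'
    _ = q ^ 2 * ((q ^ 2) ^ k - (q ^ 2) ^ d) := by ring
    _ ≤ _ := h3
    _ ≤ _ := mul_le_mul_of_nonneg_left h2 h4.le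

/-! ### Gossip matrices of stars -/

/-- The Laplacian of the star with centre `c`, divided by the number of vertices. -/
def starMatrix (c : Fin M) : Matrix (Fin M) (Fin M) ℝ := fun i j =>
  if i = c then (if j = c then 1 else 0) - 1 / (M : ℝ)
  else (1 / (M : ℝ)) * ((if j = i then 1 else 0) - (if j = c then 1 else 0))

lemma gossip_starMatrix_center (c : Fin M) (z : Fin M → Vec d) :
    gossip (starMatrix c) z c = z c - (1 / (M : ℝ)) • ∑ j, z j := by
  simp [gossip, starMatrix, sub_smul, Finset.sum_sub_distrib, Finset.smul_sum]

lemma gossip_starMatrix (c : Fin M) (z : Fin M → Vec d) {i : Fin M} (hi : i ≠ c) :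
    gossip (starMatrix c) z i = (1 / (M : ℝ)) • (z i - z c) := by
  simp [gossip, starMatrix, hi, mul_smul, sub_smul, Finset.sum_sub_distrib, ← Finset.smul_sum]

lemma gossip_zero (z : Fin M → Vec d) : gossip 0 z = 0 := by
  ext1 i; simp [gossip]

lemma gossip_starMatrix_const (c : Fin M) (z : Fin M → Vec d) (hz : ∀ i j, z i = z j) :
    gossip (starMatrix c) z = 0 := by
  have hM : (M : ℝ) ≠ 0 := by exact_mod_cast (Fin.pos c).ne'
  ext1 i
  by_cases hi : i = c
  · subst hi
    rw [gossip_starMatrix_center, Finset.sum_congr rfl fun j _ => hz j i]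
    simp [← Nat.cast_smul_eq_nsmul ℝ, smul_smul, hM]
  · rw [gossip_starMatrix c z hi, hz i c]; simp

lemma sum_gossip_starMatrix (c : Fin M) (z : Fin M → Vec d) :
    ∑ i, gossip (starMatrix c) z i = 0 := by
  have hM : (M : ℝ) ≠ 0 := by exact_mod_cast (Fin.pos c).ne'
  rw [← Finset.add_sum_erase _ _ (Finset.mem_univ c), gossip_starMatrix_center,
    Finset.sum_congr rfl fun i hi => gossip_starMatrix c z (Finset.ne_of_mem_erase hi),
    ← Finset.smul_sum, Finset.sum_erase (f := fun i => z i - z c) _ (sub_self (z c)),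
    Finset.sum_sub_distrib, smul_sub]
  simp [← Nat.cast_smul_eq_nsmul ℝ, smul_smul, hM]

lemma norm_convex_comb_sq_le {E : Type*} [SeminormedAddCommGroup E] [NormedSpace ℝ E] (x y : E)
    {p : ℝ} (h0 : 0 ≤ p) (h1 : p ≤ 1) :
    ‖(1 - p) • x + p • y‖ ^ 2 ≤ (1 - p) * ‖x‖ ^ 2 + p * ‖y‖ ^ 2 := by
  have h : ‖(1 - p) • x + p • y‖ ≤ (1 - p) * ‖x‖ + p * ‖y‖ := by
    refine (norm_add_le _ _).trans ?_
    rw [norm_smul, norm_smul, Real.norm_of_nonneg h0, Real.norm_of_nonneg (by linarith)]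
  have h2 := pow_le_pow_left₀ (norm_nonneg _) h 2
  nlinarith [mul_nonneg (mul_nonneg h0 (sub_nonneg.2 h1)) (sq_nonneg (‖x‖ - ‖y‖))]

/-- On families with sum zero, `I - W` sends the centre to the mean, which is `0`, and every other
`z i` to `(1 - 1/M) z i + (1/M) z c`. By convexity the `M - 1` leaves together contribute the weight
`1 - 1/M` of `‖z c‖²`. -/
lemma starMatrix_contraction (c : Fin M) (z : Fin M → Vec d) (hz : ∑ i, z i = 0) :
    ∑ i, ‖gossip (starMatrix c) z i - z i‖ ^ 2 ≤ (1 - 1 / (M : ℝ)) * ∑ i, ‖z i‖ ^ 2 := by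
  have hM : (1 : ℝ) ≤ M := by exact_mod_cast Fin.pos c
  have hM0 : (M : ℝ) ≠ 0 := by positivity
  have hp0 : (0 : ℝ) ≤ 1 / M := by positivity
  have hp1 : (1 : ℝ) / M ≤ 1 := by rw [div_le_one (by positivity)]; exact hM
  have key : ∀ i ∈ Finset.univ.erase c, ‖gossip (starMatrix c) z i - z i‖ ^ 2
      ≤ (1 - 1 / (M : ℝ)) * ‖z i‖ ^ 2 + (1 / (M : ℝ)) * ‖z c‖ ^ 2 := fun i hi => by
    rw [gossip_starMatrix c z (Finset.ne_of_mem_erase hi)]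
    refine le_trans (le_of_eq ?_) (norm_convex_comb_sq_le (z i) (z c) hp0 hp1)
    rw [← norm_neg]
    congr 2
    module
  have hc : ‖gossip (starMatrix c) z c - z c‖ ^ 2 = 0 := by
    rw [gossip_starMatrix_center, hz]; simp
  rw [← Finset.add_sum_erase _ _ (Finset.mem_univ c), hc, zero_add,
    ← Finset.add_sum_erase _ (fun i => ‖z i‖ ^ 2) (Finset.mem_univ c)]
  refine (Finset.sum_le_sum key).trans (le_of_eq ?_)
  rw [Finset.sum_add_distrib, ← Finset.mul_sum, Finset.sum_const,
    Finset.card_erase_of_mem (Finset.mem_univ c), Finset.card_univ, Fintype.card_fin,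
    nsmul_eq_mul, Nat.cast_sub (Fin.pos c)]
  field_simp
  push_cast
  ring

/-! ### Rotating stars -/

/-- The centre of the star at time `t`. -/
def starCenter (hM : 3 ≤ M) (B t : ℕ) : Fin M :=
  ⟨1 + (t / B) % (M - 2), by have := Nat.mod_lt (t / B) (show 0 < M - 2 by omega); omega⟩

/-- The gossip matrices of the rotating stars. -/
def starGossip (hM : 3 ≤ M) (B t : ℕ) : Matrix (Fin M) (Fin M) ℝ :=
  if B ∣ t + 1 then starMatrix (starCenter hM B t) else 0

lemma mixing_add (W : ℕ → Matrix (Fin M) (Fin M) ℝ) (t S T : ℕ) :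
    mixing W t (S + T) = mixing W (t + S) T * mixing W t S := by
  induction T with
  | zero => simp [mixing]
  | succ T ih => rw [← add_assoc, mixing, mixing, ih, mul_assoc, add_assoc]

lemma mixing_eq_one (W : ℕ → Matrix (Fin M) (Fin M) ℝ) (t T : ℕ)
    (h : ∀ τ, t ≤ τ → τ < t + T → W τ = 0) : mixing W t T = 1 := by
  induction T with
  | zero => rfl
  | succ T ih =>
    rw [mixing, ih fun τ h1 h2 => h τ h1 (by omega), h (t + T) (by omega) (by omega)]
    simp

/-- The only time in a window of length `B` at which the graph is not empty. -/
lemma exists_star_time {B : ℕ} (hB : 0 < B) (t : ℕ) :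
    ∃ S T, S + (1 + T) = B ∧ B ∣ t + S + 1 ∧
      ∀ τ, t ≤ τ → τ < t + B → B ∣ τ + 1 → τ = t + S := by
  have hlt := Nat.mod_lt t hB
  have hdiv : B ∣ t + (B - 1 - t % B) + 1 := by
    refine ⟨t / B + 1, ?_⟩
    have := Nat.div_add_mod t B
    rw [mul_add, mul_one]
    omega
  refine ⟨B - 1 - t % B, t % B, by omega, hdiv, fun τ h1 h2 h3 => ?_⟩
  obtain ⟨x, hx⟩ := h3
  obtain ⟨y, hy⟩ := hdiv
  rcases lt_trichotomy x y with h | rfl | h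
  · have := Nat.mul_le_mul_left B (Nat.succ_le_of_lt h)
    rw [Nat.mul_succ] at this
    omega
  · omega
  · have := Nat.mul_le_mul_left B (Nat.succ_le_of_lt h)
    rw [Nat.mul_succ] at this
    omega

/-- A window of length `B` contains exactly one star; all other factors of the product are the
identity. -/
lemma exists_multiGossip_eq (hM : 3 ≤ M) {B : ℕ} (hB : 0 < B) (t : ℕ) :
    ∃ c, multiGossip (starGossip hM B) B t = starMatrix c := by
  obtain ⟨S, T, hST, hdiv, huniq⟩ := exists_star_time hB t
  refine ⟨starCenter hM B (t + S), ?_⟩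
  have h0 : ∀ τ, t ≤ τ → τ < t + B → τ ≠ t + S → starGossip hM B τ = 0 :=
    fun τ h1 h2 h3 => if_neg fun h => h3 (huniq τ h1 h2 h)
  have e : mixing (starGossip hM B) t B = 1 - starGossip hM B (t + S) := by
    have := mixing_add (starGossip hM B) t S (1 + T)
    rw [hST] at this
    rw [this, mixing_add,
      mixing_eq_one _ t S fun τ h1 h2 => h0 τ h1 (by omega) (by omega),
      mixing_eq_one _ (t + S + 1) T fun τ h1 h2 => h0 τ (by omega) (by omega) (by omega)]
    simp [mixing]
  rw [multiGossip, e, sub_sub_cancel, starGossip, if_pos hdiv]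

lemma rotatingStar_adj (hM : 3 ≤ M) {B t : ℕ} {i j : Fin M} :
    (rotatingStar M B t).Adj i j ↔
      B ∣ t + 1 ∧ i ≠ j ∧ (i = starCenter hM B t ∨ j = starCenter hM B t) := by
  simp [rotatingStar, starCenter, Fin.ext_iff]

theorem isGossipNetwork_starGossip (hM : 3 ≤ M) {B : ℕ} (hB : 0 < B) {χ : ℝ} (hχ : (M : ℝ) ≤ χ) :
    IsGossipNetwork d (rotatingStar M B) (starGossip hM B) B χ where
  connected t i j := by
    obtain ⟨S, T, hST, hdiv, -⟩ := exists_star_time hB t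
    have step : ∀ i j, i ≠ j → i = starCenter hM B (t + S) ∨ j = starCenter hM B (t + S) →
        ∃ τ, t ≤ τ ∧ τ < t + B ∧ (rotatingStar M B τ).Adj i j := fun i j hij h =>
      ⟨t + S, by omega, by omega, (rotatingStar_adj hM).2 ⟨hdiv, hij, h⟩⟩
    have h1 : Relation.ReflTransGen
        (fun a b => ∃ τ, t ≤ τ ∧ τ < t + B ∧ (rotatingStar M B τ).Adj a b) i
        (starCenter hM B (t + S)) := by
      by_cases hi : i = starCenter hM B (t + S)
      · rw [← hi]
      · exact .single (step _ _ hi (.inr rfl))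
    refine h1.trans ?_
    by_cases hj : j = starCenter hM B (t + S)
    · rw [← hj]
    · exact .single (step _ _ (Ne.symm hj) (.inl rfl))
  support t i j hij := by
    have hM0 : (M : ℝ) ≠ 0 := by norm_cast; omega
    rw [rotatingStar_adj hM, starGossip]
    split_ifs with h
    · by_cases hi : i = starCenter hM B t
      · have : j ≠ starCenter hM B t := fun h => hij (hi.trans h.symm)
        simp [starMatrix, h, hi, this, this.symm, hM0]
      · by_cases hj : j = starCenter hM B t <;>
          simp [starMatrix, h, hi, hj, Ne.symm hi, hij.symm, hM0, hij]
    · simp [h]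
  ker t z hz := by
    unfold starGossip
    split_ifs
    · exact gossip_starMatrix_const _ z hz
    · exact gossip_zero z
  range t z := by
    unfold starGossip
    split_ifs
    · exact sum_gossip_starMatrix _ z
    · simp [gossip_zero]
  one_le := by
    have : (3 : ℝ) ≤ M := by exact_mod_cast hM
    linarith
  contraction t z := by
    rintro ⟨y, rfl⟩
    obtain ⟨c, hc⟩ := exists_multiGossip_eq hM hB t
    rw [hc]
    refine (starMatrix_contraction c _ (sum_gossip_starMatrix c y)).trans ?_
    refine mul_le_mul_of_nonneg_right ?_ (Finset.sum_nonneg fun _ _ => sq_nonneg _)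
    have h3 : (3 : ℝ) ≤ M := by exact_mod_cast hM
    have : χ⁻¹ ≤ 1 / (M : ℝ) := by
      rw [one_div]; exact inv_anti₀ (by linarith) hχ
    linarith

/-! ### Sampling -/

lemma card_powersetCard_erase {b : ℕ} (hb : b ≤ n) (i : Fin n) :
    (Finset.powersetCard b (Finset.univ.erase i)).card * n
      = (Finset.powersetCard b (Finset.univ : Finset (Fin n))).card * (n - b) := by
  obtain ⟨m, rfl⟩ : ∃ m, n = m + 1 := ⟨n - 1, by have := Fin.pos i; omega⟩
  simpa using Nat.choose_mul_succ_eq m b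

lemma batches_nonempty {b : Fin M → ℕ} (hb : ∀ m, b m ≤ n) : (batches n b).Nonempty := by
  rw [batches, Fintype.piFinset_nonempty]
  intro m
  rw [Finset.powersetCard_nonempty]
  simpa using hb m

/-- A given operator of worker `w` is missed by the batch with probability `1 - b w / n`. -/
lemma card_batches_filter_notMem {b : Fin M → ℕ} (w : Fin M) (hb : b w ≤ n) (i : Fin n) :
    (((batches n b).filter fun S => i ∉ S w).card : ℝ)
      = (1 - b w / n) * (batches n b).card := by
  have hn : (n : ℝ) ≠ 0 := by exact_mod_cast (Fin.pos i).ne'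
  -- The filtered set is again a product, with only the factor of `w` changed.
  have e : ((batches n b).filter fun S => i ∉ S w) = Fintype.piFinset (Function.update
      (fun m => Finset.powersetCard (b m) (Finset.univ : Finset (Fin n))) w
      (Finset.powersetCard (b w) (Finset.univ.erase i))) := by
    ext S
    simp only [batches, Finset.mem_filter, Fintype.mem_piFinset]
    constructor
    · rintro ⟨h1, h2⟩ m
      by_cases hm : m = w
      · subst hm
        have := h1 m
        rw [Finset.mem_powersetCard] at this
        simp only [Function.update_self, Finset.mem_powersetCard]
        exact ⟨fun x hx => Finset.mem_erase.2 ⟨fun h => h2 (h ▸ hx), Finset.mem_univ _⟩, this.2⟩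
      · rw [Function.update_of_ne hm]
        exact h1 m
    · intro h
      have hw := h w
      rw [Function.update_self, Finset.mem_powersetCard] at hw
      refine ⟨fun m => ?_, fun hi => by simpa using hw.1 hi⟩
      by_cases hm : m = w
      · subst hm
        exact Finset.mem_powersetCard.2 ⟨Finset.subset_univ _, hw.2⟩
      · simpa [Function.update_of_ne hm] using h m
  have key : ((batches n b).filter fun S => i ∉ S w).card * n
      = (batches n b).card * (n - b w) := by
    rw [e, batches, Fintype.card_piFinset, Fintype.card_piFinset,
      ← Finset.mul_prod_erase _ _ (Finset.mem_univ w),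
      ← Finset.mul_prod_erase _ (fun m => (Finset.powersetCard (b m) _).card) (Finset.mem_univ w),
      Function.update_self, mul_right_comm, card_powersetCard_erase hb i, mul_right_comm]
    congr 2
    refine Finset.prod_congr rfl fun m hm => ?_
    rw [Function.update_of_ne (Finset.ne_of_mem_erase hm)]
  have key' : (((batches n b).filter fun S => i ∉ S w).card : ℝ) * n
      = (batches n b).card * (n - b w) := by
    rw [← Nat.cast_sub hb]
    exact_mod_cast key
  field_simp
  linarith

/-- The chord of the convex function `exp` over `[-δ, 0]`. It converts a probability `p` of gaining
a coordinate into a deterministic cost `p` in the exponent. -/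
lemma exp_neg_mul_le {δ p : ℝ} (h0 : 0 ≤ p) (h1 : p ≤ 1) :
    Real.exp (-(δ * p)) ≤ (1 - p) + p * Real.exp (-δ) := by
  have := convexOn_exp.2 (Set.mem_univ 0) (Set.mem_univ (-δ)) (sub_nonneg.2 h1) h0 (by ring)
  simp only [smul_eq_mul, mul_zero, zero_add, Real.exp_zero, mul_one] at this
  rwa [show p * -δ = -(δ * p) by ring] at this

/-! ### Problems with a chain structure -/

lemma isProx_zero {ρ : ℝ} {w p : Vec d} (h : IsProx 0 ρ w p) : p = w := by
  have h1 := h w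
  simp only [Pi.zero_apply, mul_zero, zero_add, sub_self, norm_zero] at h1
  rw [EReal.coe_le_coe_iff] at h1
  rw [← sub_eq_zero, ← norm_eq_zero]
  nlinarith [norm_nonneg (p - w)]

/-- With `g = 0` the prox is the identity, so a local iteration amounts to one application of the
batch sum. -/
lemma localSpan_zero_le {G : Vec d → Vec d} {A : Set (Vec d)} {V : Submodule ℝ (Vec d)}
    (hA : A ⊆ V) (hG : ∀ z ∈ A, G z ∈ V) : localSpan 0 G A ≤ V := by
  have h : A ∪ G '' A ⊆ V := by
    rintro z (hz | ⟨y, hy, rfl⟩)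
    exacts [hA hz, hG y hy]
  refine Submodule.span_le.2 (Set.union_subset h ?_)
  rintro p ⟨ρ, -, w, hw, hp⟩
  rw [isProx_zero hp]
  exact Submodule.span_le.2 h hw

/-- The worker that holds the link between the coordinates `k` and `k + 1`. -/
def owner (hM : 3 ≤ M) (k : ℕ) : Fin M :=
  if Odd k then ⟨0, by omega⟩ else ⟨M - 1, by omega⟩

/-- The operators enlarge the support by at most one coordinate, and only the operator
number `k % n` of the worker `owner k` passes from the first `k` coordinates to the next one. -/
structure IsChain (hM : 3 ≤ M) (P : Problem M n d) : Prop where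
  g_eq : P.g = 0
  step : ∀ m i (k : ℕ) z, 1 ≤ k → z ∈ firstCoords d k → P.F m i z ∈ firstCoords d (k + 1)
  stay : ∀ m (i : Fin n) (k : ℕ) z, 1 ≤ k → z ∈ firstCoords d k →
    ¬ (m = owner hM k ∧ (i : ℕ) = k % n) → P.F m i z ∈ firstCoords d k

lemma communicated_subset {G : Digraph (Fin M)} {mem : Fin M → Set (Vec d)} {m : Fin M}
    {V : Submodule ℝ (Vec d)} (h : ∀ i, i = m ∨ G.Adj i m → mem i ⊆ V) :
    communicated G mem m ⊆ V :=
  Submodule.span_le.2 (Set.iUnion₂_subset h)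

/-! ### The lower bound on local computations -/

/-- Induction on the decision tree, with the current support `k` and the remaining budgets of the
two owners in the exponent. Other workers cannot enlarge the joint support. -/
theorem IsChain.le_expect_of_computations {hM : 3 ≤ M} (hn : 0 < n) {P : Problem M n d}
    (hP : IsChain hM P) (G : ℕ → Digraph (Fin M)) {δ R D : ℝ} (hδ : 0 ≤ δ) (hR : 0 ≤ R)
    {φ : Vec d → ℝ} (hφ : ∀ k : ℕ, ∀ z ∈ firstCoords d k, Real.exp (-(δ * k)) * R - D ≤ φ z)
    (p : Procedure M n d) :
    ∀ (K : ℕ) (N : Fin M → ℕ) (t : ℕ) (mem : Fin M → Set (Vec d)) (k : ℕ), 1 ≤ k →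
      (∀ m, mem m ⊆ firstCoords d k) → p.Admissible P G K N t mem →
      Real.exp (-(δ * (k + ((N ⟨0, by omega⟩ + N ⟨M - 1, by omega⟩ : ℕ) : ℝ) / n))) * R - D
        ≤ p.expect φ := by
  have hn' : (0 : ℝ) < n := by exact_mod_cast hn
  induction p with
  | output z =>
    intro K N t mem k hk hmem h
    rw [Procedure.Admissible] at h
    refine le_trans ?_ (hφ k z (Submodule.span_le.2 (Set.iUnion_subset hmem) h))
    gcongr
    exact le_add_of_nonneg_right (by positivity)
  | communicate next ih =>
    intro K N t mem k hk hmem h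
    rw [Procedure.Admissible] at h
    exact ih _ N _ _ k hk (fun m => communicated_subset fun i _ => hmem i) h.2
  | coin j w next ih =>
    intro K N t mem k hk hmem h
    rw [Procedure.Admissible] at h
    obtain ⟨h0, h1, h2⟩ := h
    rw [Procedure.expect]
    calc _ = ∑ j, w j * (Real.exp (-(δ * (k + ((N ⟨0, by omega⟩ + N ⟨M - 1, by omega⟩ : ℕ) : ℝ)
          / n))) * R - D) := by rw [← Finset.sum_mul, h1, one_mul]
      _ ≤ _ := Finset.sum_le_sum fun j _ =>
          mul_le_mul_of_nonneg_left (ih j _ N _ _ k hk hmem (h2 j)) (h0 j)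
  | compute b add next ih =>
    intro K N t mem k hk hmem h
    rw [Procedure.Admissible] at h
    obtain ⟨hb, h⟩ := h
    set i₀ : Fin n := ⟨k % n, Nat.mod_lt _ hn⟩ with hi₀
    set w := owner hM k with hw
    -- The exponent after this iteration if no coordinate is gained; a gain adds `δ`.
    set E : ℝ := δ * (k + ((N ⟨0, by omega⟩ - b ⟨0, by omega⟩
      + (N ⟨M - 1, by omega⟩ - b ⟨M - 1, by omega⟩) : ℕ) : ℝ) / n) with hE
    have hS : ∀ S ∈ batches n b,
        (if i₀ ∉ S w then Real.exp (-E) else Real.exp (-E) * Real.exp (-δ)) * R - D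
          ≤ (next S).expect φ := by
      intro S hSb
      obtain ⟨hadd, hadm⟩ := h S hSb
      rw [hP.g_eq] at hadd
      split_ifs with hi
      · have hm : ∀ m, mem m ⊆ firstCoords d (k + 1) := fun m =>
          (hmem m).trans (firstCoords_mono (Nat.le_succ k))
        have := ih S K (fun m => N m - b m) t _ (k + 1) (by omega)
          (fun m => Set.union_subset (hm m) fun z hz => localSpan_zero_le (hm m)
            (fun u hu => Submodule.sum_mem _ fun i _ => hP.step m i k u hk (hmem m hu))
            (hadd m z hz)) hadm
        refine le_trans (le_of_eq ?_) this
        rw [← Real.exp_add, hE]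
        push_cast
        ring_nf
      · refine ih S K (fun m => N m - b m) t _ k hk
          (fun m => Set.union_subset (hmem m) fun z hz => ?_) hadm
        refine localSpan_zero_le (hmem m) (fun u hu => Submodule.sum_mem _ fun i hi' => ?_)
          (hadd m z hz)
        refine hP.stay m i k u hk (hmem m hu) ?_
        rintro ⟨rfl, h2⟩
        exact hi (by rwa [show i₀ = i from Fin.ext h2.symm])
    have hp0 : (0 : ℝ) ≤ b w / n := by positivity
    have hp1 : (b w : ℝ) / n ≤ 1 := by
      rw [div_le_one hn']; exact_mod_cast (hb w).1
    have hcard : (0 : ℝ) < (batches n b).card := by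
      exact_mod_cast (batches_nonempty fun m => (hb m).1).card_pos
    have hc := card_batches_filter_notMem w (hb w).1 i₀
    have hc' : (((batches n b).filter fun S => ¬ i₀ ∉ S w).card : ℝ)
        = b w / n * (batches n b).card := by
      have : ((((batches n b).filter fun S => i₀ ∉ S w).card
          + ((batches n b).filter fun S => ¬ i₀ ∉ S w).card : ℕ) : ℝ) = (batches n b).card := by
        rw [Finset.card_filter_add_card_filter_not]
      rw [Nat.cast_add, hc] at this
      linarith
    have hbw : b w ≤ b ⟨0, by omega⟩ + b ⟨M - 1, by omega⟩ := by
      rw [hw, owner]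
      split_ifs <;> omega
    -- The budget spent by the two owners pays for the expected gain `b w / n`.
    have hexp : E + δ * (b w / n)
        ≤ δ * (k + ((N ⟨0, by omega⟩ + N ⟨M - 1, by omega⟩ : ℕ) : ℝ) / n) := by
      have h1 := (hb ⟨0, by omega⟩).2
      have h2 := (hb ⟨M - 1, by omega⟩).2
      rw [hE, ← mul_add, add_assoc, ← add_div]
      refine mul_le_mul_of_nonneg_left ?_ hδ
      gcongr
      norm_cast
      omega
    rw [Procedure.expect, le_div_iff₀ hcard]
    refine le_trans ?_ (Finset.sum_le_sum hS)
    rw [Finset.sum_sub_distrib, ← Finset.sum_mul, Finset.sum_ite, Finset.sum_const,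
      Finset.sum_const, Finset.sum_const, nsmul_eq_mul, nsmul_eq_mul, nsmul_eq_mul, hc, hc']
    have h3 : Real.exp (-(δ * (k + ((N ⟨0, by omega⟩ + N ⟨M - 1, by omega⟩ : ℕ) : ℝ) / n)))
        ≤ Real.exp (-E) * ((1 - b w / n) + b w / n * Real.exp (-δ)) := by
      calc _ ≤ Real.exp (-(E + δ * (b w / n))) := Real.exp_le_exp.2 (neg_le_neg hexp)
        _ = Real.exp (-E) * Real.exp (-(δ * (b w / n))) := by rw [← Real.exp_add, neg_add]
        _ ≤ _ := mul_le_mul_of_nonneg_left (exp_neg_mul_le hp0 hp1) (Real.exp_pos _).le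
    calc _ = Real.exp (-(δ * (k + ((N ⟨0, by omega⟩ + N ⟨M - 1, by omega⟩ : ℕ) : ℝ) / n)))
          * (R * (batches n b).card) - (batches n b).card * D := by ring
      _ ≤ Real.exp (-E) * ((1 - b w / n) + b w / n * Real.exp (-δ))
          * (R * (batches n b).card) - (batches n b).card * D :=
          sub_le_sub_right (mul_le_mul_of_nonneg_right h3 (by positivity)) _
      _ = _ := by ring

/-! ### The lower bound on communication rounds -/

/-- The workers that may know the coordinate number `σ / (M - 1) + 2` after `σ` stars: the owner of
the link to this coordinate, and the centres of the stars of the current sweep. -/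
def Informed (hM : 3 ≤ M) (σ : ℕ) (m : Fin M) : Prop :=
  m = owner hM (σ / (M - 1) + 1) ∨
    ∃ i < σ % (M - 1), (m : ℕ) = 1 + ((M - 1) * (σ / (M - 1)) + i) % (M - 2)

open Classical in
/-- After `σ` stars the memory of `m` is supported on the first `level σ m` coordinates. -/
def level (hM : 3 ≤ M) (σ : ℕ) (m : Fin M) : ℕ :=
  if Informed hM σ m then σ / (M - 1) + 2 else σ / (M - 1) + 1

lemma le_level (hM : 3 ≤ M) (σ : ℕ) (m : Fin M) : σ / (M - 1) + 1 ≤ level hM σ m := by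
  unfold level; split_ifs <;> omega

lemma level_le (hM : 3 ≤ M) (σ : ℕ) (m : Fin M) : level hM σ m ≤ σ / (M - 1) + 2 := by
  unfold level; split_ifs <;> omega

lemma owner_val (hM : 3 ≤ M) (k : ℕ) : (owner hM k : ℕ) = 0 ∨ (owner hM k : ℕ) = M - 1 := by
  unfold owner; split_ifs <;> simp

lemma owner_ne_center (hM : 3 ≤ M) (k x : ℕ) : (owner hM k : ℕ) ≠ 1 + x % (M - 2) := by
  have := Nat.mod_lt x (show 0 < M - 2 by omega)
  rcases owner_val hM k with h | h <;> omega

lemma owner_succ_ne (hM : 3 ≤ M) (k : ℕ) : owner hM (k + 1) ≠ owner hM k := by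
  unfold owner
  by_cases h : Odd k
  · simp only [h, if_true, Nat.odd_add_one, not_true_eq_false, if_false, ne_eq, Fin.mk.injEq]
    omega
  · simp only [h, if_false, Nat.odd_add_one, not_false_eq_true, if_true, ne_eq, Fin.mk.injEq]
    omega

/-- Consecutive links have different owners: an informed owner has just used its own link, while
centres own none. An uninformed worker is by definition not the owner of its next link. So no batch
pushes a memory beyond its level. -/
lemma ne_owner_level (hM : 3 ≤ M) (σ : ℕ) (m : Fin M) : m ≠ owner hM (level hM σ m) := by
  unfold level
  split_ifs with h
  · rintro e
    rcases h with h | ⟨i, -, h⟩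
    · exact owner_succ_ne hM _ (e.symm.trans h)
    · rw [e] at h
      exact owner_ne_center hM _ _ h
  · exact fun e => h (.inl e)

lemma level_le_level_succ (hM : 3 ≤ M) (σ : ℕ) {c i m : Fin M} (hc : (c : ℕ) = 1 + σ % (M - 2))
    (h : i = m ∨ i = c ∨ m = c) : level hM σ i ≤ level hM (σ + 1) m := by
  -- When a sweep ends, the base level rises by one and already covers the informed level of the old
  -- sweep.
  by_cases hdvd : M - 1 ∣ σ + 1
  · have e : (σ + 1) / (M - 1) = σ / (M - 1) + 1 := by rw [Nat.succ_div, if_pos hdvd]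
    have h1 := level_le hM σ i
    have h2 := le_level hM (σ + 1) m
    omega
  have e : (σ + 1) / (M - 1) = σ / (M - 1) := by rw [Nat.succ_div, if_neg hdvd, add_zero]
  have d1 := Nat.div_add_mod σ (M - 1)
  have d2 := Nat.div_add_mod (σ + 1) (M - 1)
  have d3 := Nat.mod_lt (σ + 1) (show 0 < M - 1 by omega)
  rw [e] at d2
  have e' : (σ + 1) % (M - 1) = σ % (M - 1) + 1 := by omega
  have hmono : ∀ m, Informed hM σ m → Informed hM (σ + 1) m := by
    rintro m (h | ⟨j, hj, h⟩)
    · exact .inl (by rw [e]; exact h)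
    · exact .inr ⟨j, by omega, by rw [e]; exact h⟩
  have hcs : Informed hM (σ + 1) c :=
    .inr ⟨σ % (M - 1), by omega, by rw [e, d1]; exact hc⟩
  have hcn : ¬ Informed hM σ c := by
    -- The current centre is new in this sweep: two of its stars coinciding would differ by a
    -- positive multiple of `M - 2`, but the sweep's last star is excluded here.
    rintro (h | ⟨j, hj, h⟩)
    · rw [h] at hc
      exact owner_ne_center hM _ _ hc
    · have hmod : ((M - 1) * (σ / (M - 1)) + j) ≡ σ [MOD (M - 2)] := by
        unfold Nat.ModEq; omega
      rw [Nat.modEq_iff_dvd' (by omega)] at hmod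
      have := Nat.le_of_dvd (by omega) hmod
      omega
  unfold level
  rw [e]
  by_cases hi : Informed hM σ i
  · have hm : Informed hM (σ + 1) m := by
      rcases h with rfl | rfl | rfl
      · exact hmono _ hi
      · exact absurd hi hcn
      · exact hcs
    rw [if_pos hi, if_pos hm]
  · rw [if_neg hi]
    split_ifs <;> omega

/-- The support bound holds on every branch, whatever the batches, so no probability enters. `t / B`
counts the stars seen and `T` bounds the total number of rounds. -/
theorem IsChain.le_expect_of_communications {hM : 3 ≤ M} {P : Problem M n d}
    (hP : IsChain hM P) {B : ℕ} {T : ℕ} {A : ℝ} {φ : Vec d → ℝ}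
    (hφ : ∀ z ∈ firstCoords d (T / B / (M - 1) + 2), A ≤ φ z) (p : Procedure M n d) :
    ∀ (K : ℕ) (N : Fin M → ℕ) (t : ℕ) (mem : Fin M → Set (Vec d)), t + K ≤ T →
      (∀ m, mem m ⊆ firstCoords d (level hM (t / B) m)) →
      p.Admissible P (rotatingStar M B) K N t mem → A ≤ p.expect φ := by
  induction p with
  | output z =>
    intro K N t mem ht hmem h
    rw [Procedure.Admissible] at h
    refine hφ z (Submodule.span_le.2 (Set.iUnion_subset fun m => ?_) h)
    refine (hmem m).trans (firstCoords_mono ((level_le hM _ m).trans ?_))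
    have : t / B / (M - 1) ≤ T / B / (M - 1) :=
      Nat.div_le_div_right (Nat.div_le_div_right (by omega))
    omega
  | communicate next ih =>
    intro K N t mem ht hmem h
    rw [Procedure.Admissible] at h
    refine ih _ N (t + 1) _ (by omega) (fun m => communicated_subset fun i hi => ?_) h.2
    refine (hmem i).trans (firstCoords_mono ?_)
    rw [Nat.succ_div]
    split_ifs with hdvd
    · refine level_le_level_succ hM (t / B) (c := starCenter hM B t) rfl (hi.imp_right fun h => ?_)
      exact ((rotatingStar_adj hM).1 h).2.2
    · rcases hi with rfl | h
      · rfl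
      · exact absurd h.1 hdvd
  | coin j w next ih =>
    intro K N t mem ht hmem h
    rw [Procedure.Admissible] at h
    obtain ⟨h0, h1, h2⟩ := h
    rw [Procedure.expect]
    calc A = ∑ j, w j * A := by rw [← Finset.sum_mul, h1, one_mul]
      _ ≤ _ := Finset.sum_le_sum fun j _ =>
          mul_le_mul_of_nonneg_left (ih j _ N _ _ ht hmem (h2 j)) (h0 j)
  | compute b add next ih =>
    intro K N t mem ht hmem h
    rw [Procedure.Admissible] at h
    obtain ⟨hb, h⟩ := h
    have hcard : (0 : ℝ) < (batches n b).card := by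
      exact_mod_cast (batches_nonempty fun m => (hb m).1).card_pos
    rw [Procedure.expect, le_div_iff₀ hcard, mul_comm, ← nsmul_eq_mul]
    refine Finset.card_nsmul_le_sum _ _ _ fun S hS => ?_
    obtain ⟨hadd, hadm⟩ := h S hS
    rw [hP.g_eq] at hadd
    refine ih S _ _ _ _ ht (fun m => Set.union_subset (hmem m) fun z hz => ?_) hadm
    refine localSpan_zero_le (hmem m) (fun u hu => Submodule.sum_mem _ fun i _ => ?_) (hadd m z hz)
    exact hP.stay m i _ u ((Nat.le_add_left _ _).trans (le_level hM (t / B) m)) (hmem m hu)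
      fun h => ne_owner_level hM _ m h.1

/-! ### The hard problem -/

/-- The weight of the link `k` in the operator `i` of worker `m`. -/
def linkWeight (hM : 3 ≤ M) (n : ℕ) (a : ℝ) (m : Fin M) (i : Fin n) (k : ℕ) : ℝ :=
  if m = owner hM k ∧ (i : ℕ) = k % n then n * a else 0

/-- The diagonal weight of worker `m`: only worker `1` has one, at the last coordinate. -/
def endWeight (d : ℕ) (e : ℝ) (m : Fin M) (j : ℕ) : ℝ :=
  if (m : ℕ) = 1 ∧ j + 1 = d then e else 0

/-- The constant part of the operators. -/
def sourceVec (M d : ℕ) (a : ℝ) : Vec d :=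
  WithLp.toLp 2 fun j => if (j : ℕ) = 0 then a / M else 0

/-- A chain whose links are distributed among the first and the last worker. -/
def chainProblem (hM : 3 ≤ M) (n d : ℕ) (s a e : ℝ) : Problem M n d where
  F m i z := s • z + tridiag (linkWeight hM n a m i) (endWeight d e m) z - sourceVec M d a
  g := 0

lemma sourceVec_mem {k : ℕ} (hk : 1 ≤ k) (a : ℝ) : sourceVec M d a ∈ firstCoords d k := by
  intro j hj
  have : j ≠ 0 := by omega
  by_cases h : j < d <;> simp [pad, sourceVec, h, this]

lemma isChain_chainProblem (hM : 3 ≤ M) (n d : ℕ) (s a e : ℝ) :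
    IsChain hM (chainProblem hM n d s a e) where
  g_eq := rfl
  step m i k z hk hz := Submodule.sub_mem _ (Submodule.add_mem _
    (Submodule.smul_mem _ _ (firstCoords_mono (Nat.le_succ k) hz))
    (tridiag_mem_firstCoords_succ _ _ hz)) (sourceVec_mem (by omega) a)
  stay m i k z hk hz h := Submodule.sub_mem _ (Submodule.add_mem _ (Submodule.smul_mem _ _ hz)
    (tridiag_mem_firstCoords _ _ (if_neg h) hz)) (sourceVec_mem hk a)

lemma F_sub (hM : 3 ≤ M) (s a e : ℝ) (m : Fin M) (i : Fin n) (u v : Vec d) :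
    (chainProblem hM n d s a e).F m i u - (chainProblem hM n d s a e).F m i v
      = s • (u - v) + tridiag (linkWeight hM n a m i) (endWeight d e m) (u - v) := by
  simp only [chainProblem, map_sub]
  module

lemma sum_linkWeight (hM : 3 ≤ M) (hn : 0 < n) (a : ℝ) (m : Fin M) (k : ℕ) :
    ∑ i, linkWeight hM n a m i k = if m = owner hM k then n * a else 0 := by
  have : ∀ i : Fin n, (i : ℕ) = k % n ↔ i = ⟨k % n, Nat.mod_lt _ hn⟩ := fun i => by
    rw [Fin.ext_iff]
  by_cases h : m = owner hM k <;> simp [linkWeight, h, this]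

lemma sum_linkWeight_sq (hM : 3 ≤ M) (hn : 0 < n) (a : ℝ) (m : Fin M) (k : ℕ) :
    ∑ i, linkWeight hM n a m i k ^ 2 = if m = owner hM k then (n * a) ^ 2 else 0 := by
  have : ∀ i : Fin n, (i : ℕ) = k % n ↔ i = ⟨k % n, Nat.mod_lt _ hn⟩ := fun i => by
    rw [Fin.ext_iff]
  by_cases h : m = owner hM k <;> simp [linkWeight, h, this, ite_pow]

lemma workerOp_chainProblem (hM : 3 ≤ M) (hn : 0 < n) (s a e : ℝ) (m : Fin M) (z : Vec d) :
    (chainProblem hM n d s a e).workerOp m z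
      = s • z + tridiag (fun k => if m = owner hM k then a else 0) (endWeight d e m) z
        - sourceVec M d a := by
  have hn' : (n : ℝ) ≠ 0 := by exact_mod_cast hn.ne'
  have e1 : (fun k => 1 / (n : ℝ) * ∑ i, linkWeight hM n a m i k)
      = fun k => if m = owner hM k then a else 0 := by
    ext k
    rw [sum_linkWeight hM hn]
    split_ifs
    · field_simp
    · simp
  have e2 : (fun k => 1 / (n : ℝ) * ∑ _i : Fin n, endWeight d e m k) = endWeight d e m := by
    ext k
    simp [hn']
  simp only [Problem.workerOp, chainProblem]
  rw [Finset.sum_sub_distrib, Finset.sum_add_distrib, sum_tridiag, smul_sub, smul_add,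
    smul_tridiag, e1, e2]
  simp [← Nat.cast_smul_eq_nsmul ℝ, smul_smul, hn']

lemma workerOp_sub (hM : 3 ≤ M) (hn : 0 < n) (s a e : ℝ) (m : Fin M) (u v : Vec d) :
    (chainProblem hM n d s a e).workerOp m u - (chainProblem hM n d s a e).workerOp m v
      = s • (u - v)
        + tridiag (fun k => if m = owner hM k then a else 0) (endWeight d e m) (u - v) := by
  simp only [workerOp_chainProblem hM hn, map_sub]
  module

lemma ne_owner_of_val_eq_one (hM : 3 ≤ M) {m : Fin M} (hm : (m : ℕ) = 1) (k : ℕ) :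
    m ≠ owner hM k := by
  rintro rfl
  rcases owner_val hM k with h | h <;> omega

lemma not_owner_twice (hM : 3 ≤ M) {m : Fin M} {k : ℕ} (h : m = owner hM k) :
    m ≠ owner hM (k + 1) :=
  fun h' => owner_succ_ne hM k (h'.symm.trans h)

/-- Adjacent links have different owners, and the corner weight sits at worker `1`, which owns no
link. Hence each tridiagonal part has norm at most `a`. -/
lemma isLipschitz_chainProblem (hM : 3 ≤ M) (hn : 0 < n) {s a e L : ℝ} (hs : 0 ≤ s) (he : 0 ≤ e)
    (hea : e ≤ a) (hL : s + a ≤ L) (m : Fin M) :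
    IsLipschitz L ((chainProblem hM n d s a e).workerOp m) := by
  intro u v
  have ha : 0 ≤ a := he.trans hea
  rw [workerOp_sub hM hn]
  set w := u - v
  have h1 : ‖tridiag (fun k => if m = owner hM k then a else 0) (endWeight d e m) w‖ ^ 2
      ≤ (a * ‖w‖) ^ 2 := by
    refine (norm_sq_tridiag_le _ _ (fun j => ?_) (fun j => ?_) (fun j => ?_) w).trans ?_
    · by_cases h : m = owner hM j
      · simp [not_owner_twice hM h]
      · simp [h]
    · by_cases h : (m : ℕ) = 1
      · simp [ne_owner_of_val_eq_one hM h]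
      · simp [endWeight, h]
    · by_cases h : (m : ℕ) = 1
      · simp [ne_owner_of_val_eq_one hM h]
      · simp [endWeight, h]
    · rw [mul_pow, norm_sq_eq_sum_pad w, Finset.mul_sum]
      refine Finset.sum_le_sum fun j _ => mul_le_mul_of_nonneg_right ?_ (sq_nonneg _)
      by_cases h : (m : ℕ) = 1
      · simp only [endWeight, ne_owner_of_val_eq_one hM h, if_false]
        split_ifs <;> nlinarith
      · simp only [endWeight, h, false_and, if_false]
        by_cases h2 : m = owner hM j
        · simp [h2, (owner_succ_ne hM j).symm]
        · rw [if_neg h2]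
          split_ifs <;> nlinarith
  have h2 := le_of_sq_le_sq h1 (by positivity)
  calc _ ≤ ‖s • w‖ + ‖tridiag (fun k => if m = owner hM k then a else 0) (endWeight d e m) w‖ :=
        norm_add_le _ _
    _ ≤ s * ‖w‖ + a * ‖w‖ := by
        rw [norm_smul, Real.norm_of_nonneg hs]
        gcongr
    _ ≤ L * ‖w‖ := by
        rw [← add_mul]
        gcongr

/-- Each coordinate meets at most one link of a given owner, and that link lies in a single
operator, contributing `(n a)²`. The corner is repeated in all `n` operators of worker `1`,
contributing `n e² ≤ (n a)²`. -/
lemma sum_norm_sq_tridiag_le (hM : 3 ≤ M) (hn : 0 < n) {a e : ℝ} (he : 0 ≤ e) (hea : e ≤ a)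
    (m : Fin M) (w : Vec d) :
    ∑ i, ‖tridiag (linkWeight hM n a m i) (endWeight d e m) w‖ ^ 2 ≤ (n * a) ^ 2 * ‖w‖ ^ 2 := by
  have ha : 0 ≤ a := he.trans hea
  have hn' : (1 : ℝ) ≤ n := by exact_mod_cast hn
  have h0 : ∀ i j, (m : ℕ) = 1 → linkWeight hM n a m i j = 0 := fun i j h =>
    if_neg fun h' => ne_owner_of_val_eq_one hM h j h'.1
  have h1 : ∀ j, (m : ℕ) ≠ 1 → endWeight d e m j = 0 := fun j h => if_neg fun h' => h h'.1
  calc _ ≤ ∑ i, ∑ j ∈ Finset.range d, (endWeight d e m j ^ 2 + linkWeight hM n a m i j ^ 2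
          + linkWeight hM n a m i (j + 1) ^ 2) * pad w (j + 1) ^ 2 := by
        refine Finset.sum_le_sum fun i _ =>
          norm_sq_tridiag_le _ _ (fun j => ?_) (fun j => ?_) (fun j => ?_) w
        · by_cases h : m = owner hM j
          · simp [linkWeight, not_owner_twice hM h]
          · simp [linkWeight, h]
        · by_cases h : (m : ℕ) = 1
          · simp [h0 _ _ h]
          · simp [h1 _ h]
        · by_cases h : (m : ℕ) = 1
          · simp [h0 _ _ h]
          · simp [h1 _ h]
    _ ≤ _ := by
        rw [Finset.sum_comm, norm_sq_eq_sum_pad w, Finset.mul_sum]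
        refine Finset.sum_le_sum fun j _ => ?_
        rw [← Finset.sum_mul]
        refine mul_le_mul_of_nonneg_right ?_ (sq_nonneg _)
        rw [Finset.sum_add_distrib, Finset.sum_add_distrib, sum_linkWeight_sq hM hn,
          sum_linkWeight_sq hM hn]
        by_cases h : (m : ℕ) = 1
        · simp only [ne_owner_of_val_eq_one hM h, if_false, add_zero, Finset.sum_const,
            Finset.card_univ, Fintype.card_fin, nsmul_eq_mul]
          have h2 : endWeight d e m j ^ 2 ≤ a ^ 2 := by
            unfold endWeight
            split_ifs <;> nlinarith
          nlinarith [mul_le_mul_of_nonneg_left h2 (by positivity : (0 : ℝ) ≤ n),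
            mul_nonneg (mul_nonneg (by positivity : (0 : ℝ) ≤ n) (sub_nonneg.2 hn')) (sq_nonneg a)]
        · simp only [h1 _ h]
          by_cases h2 : m = owner hM j
          · simp [h2, (owner_succ_ne hM j).symm]
          · rw [if_neg h2]
            split_ifs
            · simp
            · simpa using by positivity

lemma isAverageLipschitz_chainProblem (hM : 3 ≤ M) (hn : 0 < n) {s a e L : ℝ} (he : 0 ≤ e)
    (hea : e ≤ a) (hL : 2 * s ^ 2 + 2 * n * a ^ 2 ≤ L ^ 2) :
    (chainProblem hM n d s a e).IsAverageLipschitz L := by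
  intro m u v
  have hn' : (0 : ℝ) < n := by exact_mod_cast hn
  simp only [F_sub]
  set w := u - v
  have h1 : ∀ x y : Vec d, ‖x + y‖ ^ 2 ≤ 2 * ‖x‖ ^ 2 + 2 * ‖y‖ ^ 2 := fun x y => by
    nlinarith [parallelogram_law_with_norm ℝ x y, mul_self_nonneg ‖x - y‖]
  calc _ ≤ 1 / (n : ℝ) * ∑ i : Fin n, (2 * ‖s • w‖ ^ 2
          + 2 * ‖tridiag (linkWeight hM n a m i) (endWeight d e m) w‖ ^ 2) := by
        gcongr
        exact h1 _ _
    _ = 2 * s ^ 2 * ‖w‖ ^ 2 + 2 / n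
          * ∑ i, ‖tridiag (linkWeight hM n a m i) (endWeight d e m) w‖ ^ 2 := by
        rw [Finset.sum_add_distrib, norm_smul, mul_pow, Real.norm_eq_abs, sq_abs]
        simp only [← Finset.mul_sum, Finset.sum_const, Finset.card_univ, Fintype.card_fin,
          nsmul_eq_mul]
        field_simp
    _ ≤ 2 * s ^ 2 * ‖w‖ ^ 2 + 2 / n * ((n * a) ^ 2 * ‖w‖ ^ 2) := by
        gcongr
        exact sum_norm_sq_tridiag_le hM hn he hea m w
    _ = (2 * s ^ 2 + 2 * n * a ^ 2) * ‖w‖ ^ 2 := by field_simp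
    _ ≤ _ := by gcongr

lemma isStronglyMonotone_workerOp (hM : 3 ≤ M) (hn : 0 < n) (s a : ℝ) {e : ℝ} (he : 0 ≤ e)
    (m : Fin M) : IsStronglyMonotone s ((chainProblem hM n d s a e).workerOp m) := by
  intro u v
  rw [workerOp_sub hM hn, inner_add_left, real_inner_smul_left, real_inner_self_eq_norm_sq,
    inner_tridiag_self]
  refine le_add_of_nonneg_right (Finset.sum_nonneg fun j _ => mul_nonneg ?_ (sq_nonneg _))
  unfold endWeight
  split_ifs <;> simp [he]

lemma isStronglyMonotone_globalOp (hM : 3 ≤ M) (hn : 0 < n) {μ : ℝ} (a : ℝ) {e : ℝ} (he : 0 ≤ e) :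
    IsStronglyMonotone μ (chainProblem hM n d (μ / M) a e).globalOp := by
  intro u v
  have hM0 : (M : ℝ) ≠ 0 := by norm_cast; omega
  rw [Problem.globalOp, Problem.globalOp, ← Finset.sum_sub_distrib, sum_inner]
  calc μ * ‖u - v‖ ^ 2 = ∑ _m : Fin M, μ / M * ‖u - v‖ ^ 2 := by
        simp only [Finset.sum_const, Finset.card_univ, Fintype.card_fin, nsmul_eq_mul]
        field_simp
    _ ≤ _ := Finset.sum_le_sum fun m _ => isStronglyMonotone_workerOp hM hn (μ / M) a he m u v

lemma globalOp_geomVec (hM : 3 ≤ M) (hn : 0 < n) {μ a q : ℝ} (hq : μ * q + a * q ^ 2 = a) :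
    (chainProblem hM n d (μ / M) a (a * q)).globalOp (geomVec d q) = 0 := by
  have hM0 : (M : ℝ) ≠ 0 := by norm_cast; omega
  have e1 : (fun k => ∑ m, if m = owner hM k then a else 0) = fun _ => a := by
    ext k; simp
  have e2 : (fun k => ∑ m : Fin M, endWeight d (a * q) m k)
      = fun k => if k + 1 = d then a * q else 0 := by
    ext k
    have : ∀ m : Fin M, (m : ℕ) = 1 ↔ m = ⟨1, by omega⟩ := fun m => by rw [Fin.ext_iff]
    by_cases h : k + 1 = d <;> simp [endWeight, h, this]
  simp only [Problem.globalOp, workerOp_chainProblem hM hn]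
  rw [Finset.sum_sub_distrib, Finset.sum_add_distrib, sum_tridiag, e1, e2]
  simp only [Finset.sum_const, Finset.card_univ, Fintype.card_fin, ← Nat.cast_smul_eq_nsmul ℝ]
  ext ⟨j, hj⟩
  -- The corner weight `a q` replaces the missing term `a q^(d+1)` in the last row.
  have h2 : (if j + 1 = d then a * q else 0) * q ^ (j + 1) + a * pad (geomVec d q) (j + 2)
      = a * q ^ (j + 2) := by
    split_ifs with h
    · rw [pad_succ_of_le _ h.ge]; ring
    · rw [pad_geomVec q (show j + 1 < d by omega)]; ring
  -- The `M` sources add up to `a = a q⁰`, acting as a coordinate number `0`.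
  have h3 : a * pad (geomVec d q) j + (M : ℝ) * (if j = 0 then a / M else 0) = a * q ^ j := by
    rcases j with - | j
    · simp; field_simp
    · rw [pad_geomVec q (by omega)]; simp
  simp only [PiLp.sub_apply, PiLp.add_apply, PiLp.smul_apply, tridiag_apply, smul_eq_mul,
    PiLp.zero_apply, sourceVec]
  rw [pad_geomVec q hj, show geomVec d q ⟨j, hj⟩ = q ^ (j + 1) from rfl]
  have h4 : (M : ℝ) * (μ / M * q ^ (j + 1)) = μ * q ^ (j + 1) := by field_simp
  linear_combination h4 + h2 - h3 + q ^ j * hq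

lemma isSolution_geomVec (hM : 3 ≤ M) (hn : 0 < n) {μ a q : ℝ} (hq : μ * q + a * q ^ 2 = a) :
    (chainProblem hM n d (μ / M) a (a * q)).IsSolution (geomVec d q) := by
  refine ⟨by simp [chainProblem], fun z => ?_⟩
  rw [globalOp_geomVec hM hn hq]
  simp [chainProblem]

/-! ### The rate -/

/-- `q = √(1 + x²) - x` is the inverse of `√(1 + x²) + x ≤ 1 + x + x²/2 ≤ exp x`. -/
lemma exists_rate {x : ℝ} (hx : 0 < x) :
    ∃ q : ℝ, 0 < q ∧ q < 1 ∧ 2 * x * q + q ^ 2 = 1 ∧ Real.exp (-(2 * x)) ≤ q ^ 2 := by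
  have h0 : (0 : ℝ) ≤ 1 + x ^ 2 := by positivity
  have hs := Real.sq_sqrt h0
  set y := Real.sqrt (1 + x ^ 2) with hy
  have hy0 : 0 ≤ y := Real.sqrt_nonneg _
  have h1 : x < y := by nlinarith
  have h2 : y < 1 + x := by nlinarith
  have h3 : y ≤ 1 + x ^ 2 / 2 := by nlinarith [sq_nonneg (x ^ 2)]
  refine ⟨y - x, by linarith, by linarith, by linear_combination hs, ?_⟩
  have h4 : y + x ≤ Real.exp x := by linarith [Real.quadratic_le_exp_of_nonneg hx.le]
  have h5 : Real.exp (-x) ≤ y - x := by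
    rw [Real.exp_neg, inv_le_iff_one_le_mul₀ (Real.exp_pos x)]
    nlinarith
  calc Real.exp (-(2 * x)) = Real.exp (-x) ^ 2 := by
        rw [← Real.exp_nat_mul]; congr 1; push_cast; ring
    _ ≤ _ := pow_le_pow_left₀ (Real.exp_pos _).le h5 2

/-- `χ < M + 1 ≤ 2 (M - 1)` trades `M - 1` for `χ`, and `μ ≤ L` bounds the root by `2L/μ`. The two
extra coordinates cost `4μ/L ≤ 4`. -/
lemma communication_exponent_le {μ L χ : ℝ} {B K : ℕ} (hμ : 0 < μ) (hμL : μ ≤ L) (hB : 0 < B)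
    (hM : 3 ≤ M) (hχ : χ < M + 1) (hχ0 : 0 < χ) :
    2 * (μ / L) * (K / B / (M - 1) + 2 : ℕ)
      ≤ 4 + 64 / (1 + Real.sqrt (2 * L ^ 2 / μ ^ 2 + 1)) * (K / (B * χ)) := by
  have hL : 0 < L := hμ.trans_le hμL
  have hM' : (3 : ℝ) ≤ M := by exact_mod_cast hM
  have hB' : (0 : ℝ) < B := by exact_mod_cast hB
  have h1 : ((K / B / (M - 1) : ℕ) : ℝ) ≤ 2 * (K / (B * χ)) := by
    have hc : ((M - 1 : ℕ) : ℝ) = M - 1 := by rw [Nat.cast_sub (by omega)]; simp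
    rw [Nat.div_div_eq_div_mul]
    refine Nat.cast_div_le.trans ?_
    rw [Nat.cast_mul, hc, ← mul_div_assoc, div_le_div_iff₀ (by nlinarith) (by positivity)]
    have : χ ≤ 2 * (M - 1) := by linarith
    nlinarith [mul_le_mul_of_nonneg_left this (by positivity : (0 : ℝ) ≤ K * B)]
  have h2 : Real.sqrt (2 * L ^ 2 / μ ^ 2 + 1) ≤ 2 * L / μ := by
    rw [Real.sqrt_le_left (by positivity), div_pow, div_add_one (by positivity)]
    gcongr
    nlinarith
  have h3 : 2 * (μ / L) * 2 ≤ 64 / (1 + Real.sqrt (2 * L ^ 2 / μ ^ 2 + 1)) := by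
    rw [le_div_iff₀ (by positivity)]
    calc _ ≤ 2 * (μ / L) * 2 * (1 + 2 * L / μ) := by gcongr
      _ = 4 * (μ / L) + 8 := by field_simp; ring
      _ ≤ 64 := by
        have : μ / L ≤ 1 := (div_le_one hL).2 hμL
        linarith
  have h4 : μ / L ≤ 1 := (div_le_one hL).2 hμL
  have h5 : 0 ≤ (K : ℝ) / (B * χ) := by positivity
  have h6 : 0 ≤ μ / L := by positivity
  push_cast
  calc _ ≤ 2 * (μ / L) * (2 * (K / (B * χ)) + 2) := by gcongr
    _ = 2 * (μ / L) * 2 + 2 * (μ / L) * 2 * (K / (B * χ)) := by ring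
    _ ≤ _ := add_le_add (by linarith) (mul_le_mul_of_nonneg_right h3 h5)

/-- `N + N` is the joint budget of the two owners, and the initial coordinate costs `2μ/L ≤ 4`. -/
lemma computation_exponent_le {μ L Lbar : ℝ} {N : ℕ} (hμ : 0 < μ) (hμL : μ ≤ L) (hn : 0 < n)
    (hL : Lbar ^ 2 = n * L ^ 2) :
    2 * (μ / L) * ((1 : ℕ) + ((N + N : ℕ) : ℝ) / n)
      ≤ 4 + 16 / (n + Real.sqrt (2 * n * Lbar ^ 2 / μ ^ 2 + (n : ℝ) ^ 2)) * N := by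
  have hL0 : 0 < L := hμ.trans_le hμL
  have hn' : (0 : ℝ) < n := by exact_mod_cast hn
  have h2 : Real.sqrt (2 * n * Lbar ^ 2 / μ ^ 2 + (n : ℝ) ^ 2) ≤ n * (2 * L / μ) := by
    rw [Real.sqrt_le_left (by positivity), hL, mul_pow, div_pow, mul_div_assoc']
    rw [div_add' _ _ _ (by positivity)]
    gcongr
    have : μ ^ 2 ≤ L ^ 2 := by gcongr
    nlinarith [mul_le_mul_of_nonneg_left this (by positivity : (0 : ℝ) ≤ n ^ 2),
      (by positivity : (0 : ℝ) ≤ n ^ 2 * L ^ 2)]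
  have h4 : μ / L ≤ 1 := (div_le_one hL0).2 hμL
  have h3 : 4 * (μ / L) / n
      ≤ 16 / (n + Real.sqrt (2 * n * Lbar ^ 2 / μ ^ 2 + (n : ℝ) ^ 2)) := by
    rw [le_div_iff₀ (by positivity)]
    calc _ ≤ 4 * (μ / L) / n * (n + n * (2 * L / μ)) := by gcongr
      _ = 4 * (μ / L) + 8 := by field_simp; ring
      _ ≤ 16 := by linarith
  push_cast
  calc _ = 2 * (μ / L) + 4 * (μ / L) / n * N := by field_simp; ring
    _ ≤ _ := add_le_add (by linarith) (mul_le_mul_of_nonneg_right h3 (by positivity))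

lemma exp_neg_mul_sub_ge {E y r R : ℝ} (hE : E ≤ 4 + y) (hr : r ≤ Real.exp (-E) / 2)
    (hR : 0 ≤ R) : Real.exp (-4) / 2 * Real.exp (-y) * R ≤ Real.exp (-E) * R - r * R := by
  have h1 : Real.exp (-4) * Real.exp (-y) ≤ Real.exp (-E) := by
    rw [← Real.exp_add]
    exact Real.exp_le_exp.2 (by linarith)
  rw [← sub_mul]
  refine mul_le_mul_of_nonneg_right ?_ hR
  linarith

end DecentralizedVI

end

/-! ### The theorem: choice of parameters -/

open DecentralizedVI

theorem theorem2 :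
    ∃ c : ℝ, 0 < c ∧
      ∀ (Lbar μ χ : ℝ) (n B K N : ℕ),
        0 < μ → 0 < n → 0 < B → 3 ≤ χ → Real.sqrt n * μ ≤ Lbar →
        ∃ d₀ : ℕ, ∀ d : ℕ, d₀ ≤ d →
          ∃ (P : DecentralizedVI.Problem ⌊χ⌋₊ n d)
            (W : ℕ → Matrix (Fin ⌊χ⌋₊) (Fin ⌊χ⌋₊) ℝ) (zs : DecentralizedVI.Vec d),
            -- the problem
            P.g = 0 ∧
            (∀ m, DecentralizedVI.IsLipschitz (Lbar / Real.sqrt n) (P.workerOp m)) ∧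
            P.IsAverageLipschitz Lbar ∧
            DecentralizedVI.IsStronglyMonotone μ P.globalOp ∧
            (∀ m, DecentralizedVI.IsStronglyMonotone (μ / ⌊χ⌋₊) (P.workerOp m)) ∧
            -- its solution
            P.IsSolution zs ∧ zs ≠ 0 ∧
            -- the network
            DecentralizedVI.IsGossipNetwork d (DecentralizedVI.rotatingStar ⌊χ⌋₊ B) W B χ ∧
            -- the lower bounds
            ∀ p : DecentralizedVI.Procedure ⌊χ⌋₊ n d,
              p.IsRun P (DecentralizedVI.rotatingStar ⌊χ⌋₊ B) K N →
              c * Real.exp (-(64 / (1 + Real.sqrt (2 * (Lbar / Real.sqrt n) ^ 2 / μ ^ 2 + 1))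
                    * (K / (B * χ)))) * ‖(0 : DecentralizedVI.Vec d) - zs‖ ^ 2
                ≤ p.expect (fun z => ‖z - zs‖ ^ 2) ∧
              c * Real.exp (-(16 / (n + Real.sqrt (2 * n * Lbar ^ 2 / μ ^ 2 + (n : ℝ) ^ 2))
                    * N)) * ‖(0 : DecentralizedVI.Vec d) - zs‖ ^ 2
                ≤ p.expect (fun z => ‖z - zs‖ ^ 2) := by
  -- `exp (-4)` absorbs the additive constants of the exponents, the factor `1/2` the truncation
  -- term `q^(2d)`.
  refine ⟨Real.exp (-4) / 2, by positivity, fun Lbar μ χ n B K N hμ hn hB hχ hLbar => ?_⟩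
  have hM : 3 ≤ ⌊χ⌋₊ := Nat.le_floor (by exact_mod_cast hχ)
  have hχM : (⌊χ⌋₊ : ℝ) ≤ χ := Nat.floor_le (by linarith)
  have hχM' : χ < ⌊χ⌋₊ + 1 := Nat.lt_floor_add_one χ
  generalize ⌊χ⌋₊ = M at *
  have hn' : (1 : ℝ) ≤ n := by exact_mod_cast hn
  have hsn : 0 < Real.sqrt n := Real.sqrt_pos.2 (by linarith)
  set L := Lbar / Real.sqrt n with hLdef
  have hμL : μ ≤ L := by rw [hLdef, le_div_iff₀ hsn]; linarith
  have hL0 : 0 < L := hμ.trans_le hμL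
  have hLL : Lbar ^ 2 = n * L ^ 2 := by
    rw [hLdef, div_pow, Real.sq_sqrt (by linarith)]
    field_simp
  have hMR : (3 : ℝ) ≤ M := by exact_mod_cast hM
  obtain ⟨q, hq0, hq1, hq, hqe⟩ := exists_rate (div_pos hμ hL0)
  have hq2 : q ^ 2 < 1 := by nlinarith
  set δ := 2 * (μ / L) with hδ
  have hδ0 : 0 ≤ δ := by positivity
  have hEK := communication_exponent_le (K := K) hμ hμL hB hM hχM' (by linarith)
  have hEN := computation_exponent_le (N := N) hμ hμL hn hLL
  rw [← hδ] at hEK hEN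
  obtain ⟨d₁, hd₁⟩ := exists_pow_lt_of_lt_one
    (half_pos (Real.exp_pos (-(δ * (K / B / (M - 1) + 2 : ℕ))))) hq2
  obtain ⟨d₂, hd₂⟩ := exists_pow_lt_of_lt_one
    (half_pos (Real.exp_pos (-(δ * ((1 : ℕ) + ((N + N : ℕ) : ℝ) / n))))) hq2
  refine ⟨d₁ + d₂ + 1, fun d hd => ?_⟩
  have hr₁ : (q ^ 2) ^ d ≤ _ :=
    (pow_le_pow_of_le_one (sq_nonneg q) hq2.le (show d₁ ≤ d by omega)).trans hd₁.le
  have hr₂ : (q ^ 2) ^ d ≤ _ :=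
    (pow_le_pow_of_le_one (sq_nonneg q) hq2.le (show d₂ ≤ d by omega)).trans hd₂.le
  -- Leaves room for `a = L / 2`: `L/3 + L/2 ≤ L`, and `2 (L/3)² + 2n (L/2)² ≤ n L²`.
  have hs : μ / M ≤ L / 3 := div_le_div₀ hL0.le hμL (by norm_num) hMR
  have hs0 : 0 ≤ μ / M := by positivity
  have he0 : 0 ≤ L / 2 * q := by positivity
  have hea : L / 2 * q ≤ L / 2 := mul_le_of_le_one_right (by linarith) hq1.le
  have hqL : μ * q + L / 2 * q ^ 2 = L / 2 := by
    have : δ * L = 2 * μ := by rw [hδ]; field_simp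
    linear_combination (L / 2) * hq - (q / 2) * this
  have hchain := isChain_chainProblem hM n d (μ / M) (L / 2) (L / 2 * q)
  have hdist : ∀ k : ℕ, ∀ z ∈ firstCoords d k,
      Real.exp (-(δ * k)) * ‖geomVec d q‖ ^ 2 - (q ^ 2) ^ d * ‖geomVec d q‖ ^ 2
        ≤ ‖z - geomVec d q‖ ^ 2 := fun k z hz => by
    refine le_trans ?_ (dist_geomVec_ge hq2 hz)
    rw [← sub_mul]
    refine mul_le_mul_of_nonneg_right (sub_le_sub_right ?_ _) (sq_nonneg _)
    rw [show -(δ * k) = k * -δ by ring, Real.exp_nat_mul]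
    exact pow_le_pow_left₀ (Real.exp_pos _).le hqe k
  have hinit : ∀ k, ({0} : Set (Vec d)) ⊆ firstCoords d k := fun k => by
    simp
  refine ⟨chainProblem hM n d (μ / M) (L / 2) (L / 2 * q), starGossip hM B, geomVec d q, rfl,
    isLipschitz_chainProblem hM hn hs0 he0 hea (by linarith),
    isAverageLipschitz_chainProblem hM hn he0 hea ?_,
    isStronglyMonotone_globalOp hM hn _ he0,
    isStronglyMonotone_workerOp hM hn _ _ he0,
    isSolution_geomVec hM hn hqL, fun h => ?_,
    isGossipNetwork_starGossip hM hB hχM, fun p hp => ?_⟩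
  · rw [hLL]
    have h1 : (μ / M) ^ 2 ≤ (L / 3) ^ 2 := pow_le_pow_left₀ hs0 hs 2
    nlinarith [mul_le_mul_of_nonneg_right hn' (sq_nonneg L)]
  · have := pad_geomVec q (show 0 < d by omega)
    rw [h] at this
    simp [pad] at this
    exact hq0.ne this
  · rw [zero_sub, norm_neg]
    rw [Procedure.IsRun] at hp
    constructor
    · refine (exp_neg_mul_sub_ge hEK hr₁ (sq_nonneg _)).trans ?_
      exact hchain.le_expect_of_communications (hdist _) p K _ 0 _ (by omega)
        (fun m => hinit _) hp
    · refine (exp_neg_mul_sub_ge hEN hr₂ (sq_nonneg _)).trans ?_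
      -- The support starts at `k = 1`, not `0`, since the source gives the first coordinate for
      -- free.
      exact hchain.le_expect_of_computations hn (rotatingStar M B) hδ0 (sq_nonneg _) hdist p
        K (fun _ => N) 0 (fun _ => {0}) 1 le_rfl (fun m => hinit 1) hp
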